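/- For integers $n, k \ge 1$ let $H_n^{(k)} = \sum_{j=1}^n j^{-k}$ and $H_n = H_n^{(1)}$. Let $\zeta$ be the Riemann zeta function and $\mathrm{Li}_4(x) = \sum_{n=1}^\infty x^n/n^4$ for $|x| \le 1$. Then the following two series converge (as limits of their partial sums), with sums $$\sum_{n=1}^\infty \frac{H_n^3}{n}(-1)^{n-1} = \frac58\zeta(4) + \frac34\zeta(2)\ln^2 2 - \frac14\ln^4 2 - \frac98\zeta(3)\ln 2,$$ $$\sum_{n=1}^\infty \frac{H_nH_n^{(2)}}{n}(-1)^{n-1} = 2\,\mathrm{Li}_4\left(\tfrac12\right) + \frac1{12}\ln^4 2 + \frac78\zeta(3)\ln 2 - \frac14\zeta(2)\ln^2 2 - \zeta(4).$$ -/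

import Mathlib

open Filter Topology

/-- The generalized harmonic number `H_n^{(k)} = ∑_{j=1}^n 1 / j^k` (a rational number; it is `0`
for `n = 0`). -/
def genHarmonic (k n : ℕ) : ℚ := ∑ j ∈ Finset.Icc 1 n, 1 / (j : ℚ) ^ k

/-- Order one gives Mathlib's harmonic numbers. -/
theorem genHarmonic_one (n : ℕ) : genHarmonic 1 n = harmonic n := by
  simp [genHarmonic, harmonic_eq_sum_Icc]

/-- The polylogarithm `Li_p(x) = ∑_{n ≥ 1} x^n / n^p`, for `Re p > 1` and `|x| ≤ 1` (where the
series converges absolutely). -/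
noncomputable def polylog (p x : ℂ) : ℂ := ∑' n : ℕ, x ^ (n + 1) / ((n + 1 : ℕ) : ℂ) ^ p

/-- The series defining the polylogarithm does converge absolutely in the stated range. -/
theorem summable_polylog {p x : ℂ} (hp : 1 < p.re) (hx : ‖x‖ ≤ 1) :
    Summable fun n : ℕ => x ^ (n + 1) / ((n + 1 : ℕ) : ℂ) ^ p := by
  have h := (summable_nat_add_iff 1).2 (Complex.summable_one_div_nat_cpow.2 hp)
  refine Summable.of_norm_bounded h.norm fun n => ?_
  rw [norm_div, norm_div, norm_one, norm_pow]
  gcongr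
  exact pow_le_one₀ (norm_nonneg x) hx

/-! Let e₃, h₃, p₃ be the elementary, complete and power-sum symmetric functions of degree three in
1, 1/2, …, 1/n. Then H³ = 3(h₃ + e₃) − 2p₃ and H·H⁽²⁾ = h₃ − e₃, so it suffices to find the sums of
h₃(n)xⁿ/n, e₃(n)xⁿ/n and p₃(n)xⁿ/n for −1 < x < 0 and let x → −1.

Passing to partial sums multiplies a generating function by 1/(1−x); dividing coefficients by n
integrates it against dx/x. Hence the h₃ series is −Li₄(x/(x−1)), the e₃ series is an integral of
log³ computed in the variable y = 1/(1−x), and the p₃ series is a combination of Li₂, Li₃, Li₄ and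
log(1−x). Each formula is checked by comparing derivatives and the value at x = 0
(`eq_of_hasDerivAt_eq`).

At x = −1 both x/(x−1) and y equal 1/2. Li₂(1/2) and Li₃(1/2) come from functional equations, while
Li₄(1/2) cancels in h₃ + e₃ and doubles in e₃ − h₃. The terms eventually decrease to zero, so both
series converge by Leibniz and Abel's limit theorem identifies their sums. -/

/-! ### Power series with polynomially bounded coefficients -/

/-- The sum of the power series with coefficients `a`. -/
noncomputable def powerSum (a : ℕ → ℝ) (x : ℝ) : ℝ := ∑' n : ℕ, a n * x ^ n

/-- A sequence vanishing at `0` and bounded by a power of `n`. -/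
def PolyBounded (a : ℕ → ℝ) : Prop := a 0 = 0 ∧ ∃ p : ℕ, ∀ n, |a n| ≤ (n : ℝ) ^ p

/-- The real polylogarithm of natural order (the term `n = 0` vanishes when `k ≠ 0`). -/
noncomputable def realPolylog (k : ℕ) (x : ℝ) : ℝ := powerSum (fun n => 1 / (n : ℝ) ^ k) x

theorem PolyBounded.summable {a : ℕ → ℝ} (ha : PolyBounded a) {x : ℝ} (hx : |x| < 1) :
    Summable fun n => a n * x ^ n := by
  obtain ⟨-, p, hp⟩ := ha
  have h := summable_pow_mul_geometric_of_norm_lt_one (R := ℝ) p (r := |x|) (by simpa using hx)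
  refine Summable.of_norm_bounded h fun n => ?_
  rw [Real.norm_eq_abs, abs_mul, abs_pow]
  exact mul_le_mul_of_nonneg_right (hp n) (by positivity)

theorem PolyBounded.div_natCast {a : ℕ → ℝ} (ha : PolyBounded a) :
    PolyBounded fun n => a n / n := by
  obtain ⟨h0, p, hp⟩ := ha
  refine ⟨by simp, p, fun n => ?_⟩
  rcases Nat.eq_zero_or_pos n with rfl | hn
  · simp
  · have : (1 : ℝ) ≤ n := by exact_mod_cast hn
    rw [abs_div, Nat.abs_cast]
    exact (div_le_self (abs_nonneg _) this).trans (hp n)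

/-- Termwise differentiation, dominated by nᵖrⁿ/r on a ball with |x| < r < 1. Writing the derivative
as a quotient by x forces the exclusion of 0. -/
theorem PolyBounded.hasDerivAt {a : ℕ → ℝ} (ha : PolyBounded a) {x : ℝ} (hx : |x| < 1)
    (hx0 : x ≠ 0) :
    HasDerivAt (powerSum fun n => a n / n) (powerSum a x / x) x := by
  obtain ⟨r, hr1, hr2⟩ := exists_between hx
  have hr0 : 0 < r := (abs_nonneg x).trans_lt hr1
  obtain ⟨h0, p, hp⟩ := ha
  have hs : Summable fun n : ℕ => ((n : ℝ) ^ p * r ^ n) / r :=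
    (summable_pow_mul_geometric_of_norm_lt_one (R := ℝ) p (r := r)
      (by rwa [Real.norm_eq_abs, abs_of_pos hr0])).div_const r
  have key := hasDerivAt_tsum_of_isPreconnected (𝕜 := ℝ) (F := ℝ)
    (g := fun n x => a n / n * x ^ n)
    (g' := fun n x => a n / n * (n * x ^ (n - 1))) (t := Metric.ball 0 r) (y₀ := 0) (y := x) hs
    Metric.isOpen_ball (convex_ball 0 r).isPreconnected
    (fun n y _ => (hasDerivAt_pow n y).const_mul _)
    (fun n y hy => by
      rcases Nat.eq_zero_or_pos n with rfl | hn
      · simp; positivity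
      · have hn' : (n : ℝ) ≠ 0 := by positivity
        rw [← mul_assoc, div_mul_cancel₀ _ hn', Real.norm_eq_abs, abs_mul, abs_pow, mul_div_assoc]
        have hy' : |y| < r := by simpa using hy
        have : r ^ n / r = r ^ (n - 1) := by
          rw [div_eq_iff hr0.ne', ← pow_succ, Nat.sub_add_cancel hn]
        rw [this]
        gcongr
        exact hp n)
    (by simpa using hr0)
    (summable_of_ne_finset_zero (s := {0}) fun n hn => by
      have : n ≠ 0 := by simpa using hn
      simp [this])
    (by simpa using hr1)
  refine HasDerivAt.congr_deriv (f := powerSum fun n => a n / n) key ?_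
  symm
  rw [powerSum, ← tsum_div_const]
  refine tsum_congr fun n => ?_
  rcases Nat.eq_zero_or_pos n with rfl | hn
  · simp [h0]
  · have hn' : (n : ℝ) ≠ 0 := by positivity
    rw [← mul_assoc, div_mul_cancel₀ _ hn', mul_div_assoc]
    congr 1
    rw [div_eq_iff hx0, ← pow_succ, Nat.sub_add_cancel hn]

theorem powerSum_zero {a : ℕ → ℝ} (h0 : a 0 = 0) : powerSum a 0 = 0 := by
  rw [powerSum, ← tsum_zero (α := ℝ) (β := ℕ)]
  refine tsum_congr fun n => ?_
  rcases Nat.eq_zero_or_pos n with rfl | hn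
  · simp [h0]
  · simp [hn.ne']

/-- Covers the point excluded from `PolyBounded.hasDerivAt`, which is where the generating functions
get their initial value. -/
theorem PolyBounded.continuousAt_zero {a : ℕ → ℝ} (ha : PolyBounded a) :
    ContinuousAt (powerSum a) 0 := by
  obtain ⟨h0, p, hp⟩ := ha
  have hs := summable_pow_mul_geometric_of_norm_lt_one (R := ℝ) p (r := 1 / 2)
      (by norm_num)
  have h : ContinuousOn (powerSum a) (Metric.closedBall 0 (1 / 2)) := by
    refine continuousOn_tsum (fun n => by fun_prop) hs fun n y hy => ?_
    have hy' : |y| ≤ 1 / 2 := by simpa using hy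
    rw [Real.norm_eq_abs, abs_mul, abs_pow]
    gcongr
    exact hp n
  exact h.continuousAt (Metric.closedBall_mem_nhds _ (by norm_num))

/-- The generating function of the partial sums of a sequence. -/
theorem one_sub_mul_powerSum {s b : ℕ → ℝ} (hs : PolyBounded s) (hb : b 0 = 0)
    (h : ∀ n, s (n + 1) = s n + b (n + 1)) {x : ℝ} (hx : |x| < 1) :
    (1 - x) * powerSum s x = powerSum b x := by
  have hS := hs.summable hx
  have hb' : ∀ n, b (n + 1) * x ^ (n + 1) = s (n + 1) * x ^ (n + 1) - x * (s n * x ^ n) := by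
    intro n
    rw [h n]; ring
  have hS1 := (summable_nat_add_iff 1).2 hS
  have hB : Summable fun n => b n * x ^ n := by
    rw [← summable_nat_add_iff 1]
    simp only [hb']
    exact hS1.sub (hS.mul_left x)
  rw [powerSum, powerSum, hB.tsum_eq_zero_add, hb]
  simp only [hb']
  rw [hS1.tsum_sub (hS.mul_left x), tsum_mul_left, sub_mul, one_mul, hS.tsum_eq_zero_add, hs.1]
  ring

theorem powerSum_shift {a b : ℕ → ℝ} (hb : PolyBounded b) (h : ∀ n, b (n + 1) = a n) {x : ℝ}
    (hx : |x| < 1) : powerSum b x = x * powerSum a x := by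
  rw [powerSum, powerSum, (hb.summable hx).tsum_eq_zero_add, hb.1, ← tsum_mul_left]
  simp only [h, zero_mul, zero_add]
  exact tsum_congr fun n => by ring

/-- Mean value theorem for f − g. Derivatives are needed only inside the interval, so logarithmic
singularities at an endpoint are harmless. -/
theorem eq_of_hasDerivAt_eq {f g f' : ℝ → ℝ} {a b : ℝ} (hab : a ≤ b)
    (hf : ContinuousOn f (Set.Icc a b)) (hg : ContinuousOn g (Set.Icc a b))
    (hf' : ∀ x ∈ Set.Ioo a b, HasDerivAt f (f' x) x)
    (hg' : ∀ x ∈ Set.Ioo a b, HasDerivAt g (f' x) x) : f a - g a = f b - g b := by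
  rcases hab.eq_or_lt with rfl | hab
  · rfl
  obtain ⟨c, hc, h⟩ := exists_hasDerivAt_eq_slope (fun x => f x - g x) (fun x => f' x - f' x) hab
    (hf.sub hg) fun x hx => (hf' x hx).sub (hg' x hx)
  rw [sub_self, eq_comm, div_eq_zero_iff] at h
  rcases h with h | h <;> linarith

theorem PolyBounded.continuousOn_div {a : ℕ → ℝ} (ha : PolyBounded a) {x : ℝ} (hx : -1 < x) :
    ContinuousOn (powerSum fun n => a n / n) (Set.Icc x 0) := by
  intro y hy
  rcases hy.2.eq_or_lt with rfl | h
  · exact ha.div_natCast.continuousAt_zero.continuousWithinAt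
  · exact (ha.hasDerivAt (abs_lt.2 ⟨by linarith [hy.1], by linarith⟩)
      h.ne).continuousAt.continuousWithinAt

/-! ### Real polylogarithms and their values at ±1 -/

theorem polyBounded_one_div_pow {k : ℕ} (hk : k ≠ 0) :
    PolyBounded fun n => 1 / (n : ℝ) ^ k := by
  refine ⟨by simp [hk], 0, fun n => ?_⟩
  rcases Nat.eq_zero_or_pos n with rfl | hn
  · simp [hk]
  · have : (1 : ℝ) ≤ (n : ℝ) ^ k := one_le_pow₀ (by exact_mod_cast hn)
    rw [abs_of_nonneg (by positivity), pow_zero]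
    exact div_le_one_of_le₀ this (by positivity)

theorem realPolylog_zero {k : ℕ} (hk : k ≠ 0) : realPolylog k 0 = 0 :=
  powerSum_zero (by simp [hk])

theorem realPolylog_succ (k : ℕ) :
    realPolylog (k + 1) = powerSum fun n => 1 / (n : ℝ) ^ k / n := by
  funext x
  simp only [realPolylog, pow_succ, div_div]

theorem hasDerivAt_realPolylog {k : ℕ} (hk : k ≠ 0) {x : ℝ} (hx : |x| < 1) (hx0 : x ≠ 0) :
    HasDerivAt (realPolylog (k + 1)) (realPolylog k x / x) x := by
  rw [realPolylog_succ]
  exact (polyBounded_one_div_pow hk).hasDerivAt hx hx0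

theorem summable_realPolylog {k : ℕ} (hk : 2 ≤ k) {x : ℝ} (hx : |x| ≤ 1) :
    Summable fun n : ℕ => 1 / (n : ℝ) ^ k * x ^ n := by
  refine Summable.of_norm_bounded (Real.summable_one_div_nat_pow.2 hk) fun n => ?_
  rw [Real.norm_eq_abs, abs_mul, abs_pow, abs_of_nonneg (by positivity)]
  exact mul_le_of_le_one_right (by positivity) (pow_le_one₀ (abs_nonneg _) hx)

theorem continuousOn_realPolylog {k : ℕ} (hk : 2 ≤ k) :
    ContinuousOn (realPolylog k) (Set.Icc (-1) 1) := by
  refine continuousOn_tsum (fun n => by fun_prop) (Real.summable_one_div_nat_pow.2 hk)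
    fun n x hx => ?_
  rw [Real.norm_eq_abs, abs_mul, abs_pow, abs_of_nonneg (by positivity)]
  exact mul_le_of_le_one_right (by positivity) (pow_le_one₀ (abs_nonneg _) (abs_le.2 hx))

theorem realPolylog_one {x : ℝ} (hx : |x| < 1) : realPolylog 1 x = -Real.log (1 - x) := by
  have h := Real.hasSum_pow_div_log_of_abs_lt_one hx
  have hs := (polyBounded_one_div_pow one_ne_zero).summable hx
  rw [realPolylog, powerSum, hs.tsum_eq_zero_add, ← h.tsum_eq]
  simp only [Nat.cast_zero, pow_one, div_zero, zero_mul, zero_add]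
  refine tsum_congr fun n => ?_
  push_cast
  ring

/-- Adding the series at 1 and −1 kills the odd terms and doubles the even ones. -/
theorem realPolylog_neg_one {k : ℕ} (hk : 2 ≤ k) :
    realPolylog k (-1) = -(1 - 2 / 2 ^ k) * realPolylog k 1 := by
  have h1 : Summable fun n : ℕ => 1 / (n : ℝ) ^ k * 1 ^ n := summable_realPolylog hk (by simp)
  have h2 : Summable fun n : ℕ => 1 / (n : ℝ) ^ k * (-1) ^ n := summable_realPolylog hk (by simp)
  have hadd : realPolylog k 1 + realPolylog k (-1) = 2 / 2 ^ k * realPolylog k 1 := by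
    have hinj : Function.Injective fun n : ℕ => 2 * n := fun a b h => by simpa using h
    rw [realPolylog, realPolylog, powerSum, powerSum, ← h1.tsum_add h2, ← tsum_mul_left,
      ← hinj.tsum_eq]
    · refine tsum_congr fun n => ?_
      simp only [one_pow, pow_mul, neg_one_sq, Nat.cast_mul, Nat.cast_ofNat, mul_pow]
      field_simp
      ring
    · intro n hn
      rcases Nat.even_or_odd n with he | ho
      · obtain ⟨m, rfl⟩ := he
        exact ⟨m, by simp; ring⟩
      · exact absurd (by simp [ho.neg_one_pow]) hn
  linear_combination hadd

theorem riemannZeta_eq_realPolylog {k : ℕ} (hk : 1 < k) :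
    riemannZeta k = (realPolylog k 1 : ℂ) := by
  rw [zeta_nat_eq_tsum_of_gt_one hk, realPolylog, powerSum, Complex.ofReal_tsum]
  exact tsum_congr fun n => by simp

theorem polylog_ofReal {k : ℕ} (hk : 2 ≤ k) {x : ℝ} (hx : |x| ≤ 1) :
    polylog k x = (realPolylog k x : ℂ) := by
  rw [polylog, realPolylog, powerSum, (summable_realPolylog hk hx).tsum_eq_zero_add,
    Complex.ofReal_add, Complex.ofReal_tsum]
  have : k ≠ 0 := by omega
  simp only [Nat.cast_zero, zero_pow this, div_zero, zero_mul, Complex.ofReal_zero, zero_add]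
  refine tsum_congr fun n => ?_
  rw [Complex.cpow_natCast]
  push_cast
  ring

/-! ### Functional equations of Li₂ and Li₃, and values at 1/2 -/

/-- The simple zero of log at 1 absorbs the singularity: log z is z − 1 times a continuous slope,
and t log t is continuous at 0. The convention log 0 = 0 gives the right value at z = 1. -/
theorem continuousAt_log_mul_log_one_sub :
    ContinuousAt (fun z : ℝ => Real.log z * Real.log (1 - z)) 1 := by
  have h1 : ContinuousAt (dslope Real.log 1) 1 :=
    continuousAt_dslope_same.2 (Real.differentiableAt_log one_ne_zero)
  have h2 : Continuous fun z : ℝ => (1 - z) * Real.log (1 - z) :=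
    Real.continuous_mul_log.comp (continuous_const.sub continuous_id)
  refine (h1.neg.mul h2.continuousAt).congr (Eventually.of_forall fun z => ?_)
  have h := sub_smul_dslope Real.log 1 z
  rw [Real.log_one, sub_zero, smul_eq_mul] at h
  change -dslope Real.log 1 z * ((1 - z) * Real.log (1 - z)) = Real.log z * Real.log (1 - z)
  rw [← h]
  ring

theorem continuousOn_log_mul_log_one_sub :
    ContinuousOn (fun z : ℝ => Real.log z * Real.log (1 - z)) (Set.Ioc 0 1) := by
  intro z hz
  rcases hz.2.eq_or_lt with rfl | h
  · exact continuousAt_log_mul_log_one_sub.continuousWithinAt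
  · exact ((Real.continuousAt_log hz.1.ne').mul
      ((continuousAt_const.sub continuousAt_id).log (by simp; linarith))).continuousWithinAt

theorem HasDerivAt.realPolylog {k : ℕ} {f : ℝ → ℝ} {f' x : ℝ} (hf : HasDerivAt f f' x)
    (hk : k ≠ 0) (hx : |f x| < 1) (hx0 : f x ≠ 0) :
    HasDerivAt (fun y => realPolylog (k + 1) (f y)) (realPolylog k (f x) / f x * f') x :=
  (hasDerivAt_realPolylog hk hx hx0).comp x hf

theorem ContinuousOn.realPolylog {k : ℕ} {f : ℝ → ℝ} {s : Set ℝ} (hf : ContinuousOn f s)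
    (hk : 2 ≤ k) (hs : ∀ x ∈ s, f x ∈ Set.Icc (-1) 1) :
    ContinuousOn (fun y => realPolylog k (f y)) s :=
  (continuousOn_realPolylog hk).comp hf hs

theorem hasDerivAt_log_one_sub {x : ℝ} (hx : x < 1) :
    HasDerivAt (fun y => Real.log (1 - y)) (-1 / (1 - x)) x :=
  ((hasDerivAt_id x).const_sub 1).log (by simp; linarith)

/-- Euler's reflection formula for the dilogarithm. -/
theorem realPolylog_two_reflection {z : ℝ} (hz0 : 0 < z) (hz1 : z ≤ 1) :
    realPolylog 2 z + realPolylog 2 (1 - z) + Real.log z * Real.log (1 - z)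
      = realPolylog 2 1 := by
  have h := eq_of_hasDerivAt_eq (a := z) (b := 1) (g := fun _ => 0) (f' := fun _ => 0)
    (f := fun z => realPolylog 2 z + realPolylog 2 (1 - z) + Real.log z * Real.log (1 - z))
    hz1 ?_ continuousOn_const ?_ (fun x _ => hasDerivAt_const x 0)
  · simpa [realPolylog_zero] using h
  · refine ((continuousOn_id.realPolylog le_rfl ?_).add
      ((continuousOn_const.sub continuousOn_id).realPolylog le_rfl ?_)).add
      (continuousOn_log_mul_log_one_sub.mono ?_)
    · intro x hx; simp at hx ⊢; constructor <;> linarith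
    · intro x hx; simp at hx ⊢; constructor <;> linarith
    · intro x hx; simp at hx ⊢; constructor <;> linarith
  · intro x ⟨hx0, hx1⟩
    have hx0 : 0 < x := hz0.trans hx0
    have hx : |x| < 1 := abs_lt.2 ⟨by linarith, hx1⟩
    have hx' : |1 - x| < 1 := abs_lt.2 ⟨by linarith, by linarith⟩
    have hne : 1 - x ≠ 0 := by linarith
    refine ((((hasDerivAt_id x).realPolylog one_ne_zero hx hx0.ne').add
      (((hasDerivAt_id x).const_sub 1).realPolylog one_ne_zero hx' hne)).add
      ((Real.hasDerivAt_log hx0.ne').mul (hasDerivAt_log_one_sub hx1))).congr_deriv ?_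
    simp only [id]
    rw [realPolylog_one hx, realPolylog_one hx', sub_sub_cancel]
    field_simp
    ring

/-- Landen's formula for the dilogarithm. -/
theorem realPolylog_two_landen {z : ℝ} (hz0 : 1 / 2 < z) (hz1 : z ≤ 1) :
    realPolylog 2 (1 - z) + realPolylog 2 (1 - 1 / z) = -(Real.log z ^ 2 / 2) := by
  have h := eq_of_hasDerivAt_eq (a := z) (b := 1) (g := fun _ => 0) (f' := fun _ => 0)
    (f := fun z => realPolylog 2 (1 - z) + realPolylog 2 (1 - 1 / z) + Real.log z ^ 2 / 2)
    hz1 ?_ continuousOn_const ?_ (fun x _ => hasDerivAt_const x 0)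
  · simp [realPolylog_zero] at h
    rw [one_div]
    linarith
  · refine (((continuousOn_const.sub continuousOn_id).realPolylog le_rfl ?_).add
      (ContinuousOn.realPolylog (f := fun z => 1 - 1 / z) ?_ le_rfl ?_)).add ?_
    · intro x hx; simp at hx ⊢; constructor <;> linarith
    · exact continuousOn_const.sub (continuousOn_const.div continuousOn_id
        fun x hx => by simp at hx ⊢; linarith)
    · intro x hx
      have hx0 : 0 < x := by linarith [hx.1]
      have h2 : 1 / x ≤ 2 := by rw [div_le_iff₀ hx0]; linarith [hx.1]
      have h1 : 0 < 1 / x := by positivity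
      constructor <;> linarith
    · refine ContinuousOn.div_const (ContinuousOn.pow (Real.continuousOn_log.mono ?_) 2) 2
      intro x hx
      have hx0 : 0 < x := by linarith [hx.1]
      exact hx0.ne'
  · intro x ⟨hx0, hx1⟩
    have hx0 : 1 / 2 < x := hz0.trans hx0
    have hxpos : 0 < x := by linarith
    have hx' : |1 - x| < 1 := abs_lt.2 ⟨by linarith, by linarith⟩
    have hne : 1 - x ≠ 0 := by linarith
    have h2 : 1 / x < 2 := by rw [div_lt_iff₀ hxpos]; linarith
    have h1 : 1 < 1 / x := by rw [lt_div_iff₀ hxpos]; linarith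
    have hx'' : |1 - 1 / x| < 1 := abs_lt.2 ⟨by linarith, by linarith⟩
    have hne' : 1 - 1 / x ≠ 0 := by linarith
    have hinv : HasDerivAt (fun z : ℝ => 1 - 1 / z) (1 / x ^ 2) x := by
      simpa using (hasDerivAt_inv hxpos.ne').const_sub 1
    refine (((((hasDerivAt_id x).const_sub 1).realPolylog one_ne_zero hx' hne).add
      (hinv.realPolylog one_ne_zero hx'' hne')).add
      (((Real.hasDerivAt_log hxpos.ne').pow 2).div_const 2)).congr_deriv ?_
    simp only [id]
    rw [realPolylog_one hx', realPolylog_one hx'', sub_sub_cancel, sub_sub_cancel,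
      one_div, Real.log_inv]
    have hne3 : x - 1 ≠ 0 := by linarith
    field_simp
    ring

/-- The three-term relation for the trilogarithm. -/
theorem realPolylog_three_add {z : ℝ} (hz0 : 1 / 2 ≤ z) (hz1 : z ≤ 1) :
    realPolylog 3 z + realPolylog 3 (1 - z) + realPolylog 3 (1 - 1 / z)
      = realPolylog 3 1 + Real.log z ^ 3 / 6 + realPolylog 2 1 * Real.log z
        - Real.log z * (Real.log z * Real.log (1 - z)) / 2 := by
  have h := eq_of_hasDerivAt_eq (a := z) (b := 1) (g := fun _ => 0) (f' := fun _ => 0)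
    (f := fun z => realPolylog 3 z + realPolylog 3 (1 - z) + realPolylog 3 (1 - 1 / z)
      - (Real.log z ^ 3 / 6 + realPolylog 2 1 * Real.log z
        - Real.log z * (Real.log z * Real.log (1 - z)) / 2))
    hz1 ?_ continuousOn_const ?_ (fun x _ => hasDerivAt_const x 0)
  · simp [realPolylog_zero] at h
    rw [one_div]
    linarith
  · have hlog : ContinuousOn Real.log (Set.Icc z 1) := Real.continuousOn_log.mono fun x hx => by
      have hx0 : 0 < x := by linarith [hx.1]
      exact hx0.ne'
    refine (((continuousOn_id.realPolylog (by norm_num) ?_).add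
      ((continuousOn_const.sub continuousOn_id).realPolylog (by norm_num) ?_)).add
      (ContinuousOn.realPolylog (f := fun z => 1 - 1 / z) ?_ (by norm_num) ?_)).sub
      ((((hlog.pow 3).div_const 6).add (continuousOn_const.mul hlog)).sub
      ((hlog.mul (continuousOn_log_mul_log_one_sub.mono ?_)).div_const 2))
    · intro x hx; simp at hx ⊢; constructor <;> linarith
    · intro x hx; simp at hx ⊢; constructor <;> linarith
    · exact continuousOn_const.sub (continuousOn_const.div continuousOn_id
        fun x hx => by simp at hx ⊢; linarith)
    · intro x hx
      have hx0 : 0 < x := by linarith [hx.1]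
      have h2 : 1 / x ≤ 2 := by rw [div_le_iff₀ hx0]; linarith [hx.1]
      have h1 : 0 < 1 / x := by positivity
      constructor <;> linarith
    · intro x hx; simp at hx ⊢; constructor <;> linarith
  · intro x ⟨hx0, hx1⟩
    have hx0 : 1 / 2 < x := hz0.trans_lt hx0
    have hxpos : 0 < x := by linarith
    have hx : |x| < 1 := abs_lt.2 ⟨by linarith, hx1⟩
    have hx' : |1 - x| < 1 := abs_lt.2 ⟨by linarith, by linarith⟩
    have hne : 1 - x ≠ 0 := by linarith
    have h2 : 1 / x < 2 := by rw [div_lt_iff₀ hxpos]; linarith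
    have h1 : 1 < 1 / x := by rw [lt_div_iff₀ hxpos]; linarith
    have hx'' : |1 - 1 / x| < 1 := abs_lt.2 ⟨by linarith, by linarith⟩
    have hne' : 1 - 1 / x ≠ 0 := by linarith
    have hinv : HasDerivAt (fun z : ℝ => 1 - 1 / z) (1 / x ^ 2) x := by
      simpa using (hasDerivAt_inv hxpos.ne').const_sub 1
    have hlog := Real.hasDerivAt_log hxpos.ne'
    refine (((((hasDerivAt_id x).realPolylog two_ne_zero hx hxpos.ne').add
      (((hasDerivAt_id x).const_sub 1).realPolylog two_ne_zero hx' hne)).add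
      (hinv.realPolylog two_ne_zero hx'' hne')).sub
      ((((hlog.pow 3).div_const 6).add (hlog.const_mul _)).sub
      ((hlog.mul (hlog.mul (hasDerivAt_log_one_sub hx1))).div_const 2))).congr_deriv ?_
    simp only [id, Pi.mul_apply]
    have e1 := realPolylog_two_reflection hxpos hx1.le
    have e2 := realPolylog_two_landen hx0 hx1.le
    have hne3 : x - 1 ≠ 0 := by linarith
    -- Differentiating lowers Li₃ to Li₂; reflection and Landen eliminate Li₂(1) and Li₂(1 − 1/x),
    -- after which the dilogarithms cancel.
    rw [← e1, eq_sub_of_add_eq' e2]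
    field_simp
    ring

theorem realPolylog_two_half :
    realPolylog 2 (1 / 2) = realPolylog 2 1 / 2 - Real.log 2 ^ 2 / 2 := by
  have h := realPolylog_two_reflection (z := 1 / 2) (by norm_num) (by norm_num)
  rw [show (1 : ℝ) - 1 / 2 = 1 / 2 by norm_num, one_div, Real.log_inv] at h
  rw [one_div]
  linarith

/-- At z = 1/2 the three arguments are 1/2, 1/2 and −1, and Li₃(−1) = −(3/4)Li₃(1). -/
theorem realPolylog_three_half :
    realPolylog 3 (1 / 2)
      = 7 / 8 * realPolylog 3 1 - realPolylog 2 1 * Real.log 2 / 2 + Real.log 2 ^ 3 / 6 := by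
  have h := realPolylog_three_add (z := 1 / 2) (by norm_num) (by norm_num)
  rw [show (1 : ℝ) - 1 / 2 = 1 / 2 by norm_num, show (1 : ℝ) - 1 / (1 / 2) = -1 by norm_num,
    realPolylog_neg_one (by norm_num), one_div, Real.log_inv] at h
  rw [one_div]
  linarith

/-! ### Inductive steps for the generating functions -/

/-- If a power series sums to `-Li_k(x / (x - 1))`, then the one with coefficients `s n / n`, where
`s` are the partial sums of its coefficients, sums to `-Li_{k+1}(x / (x - 1))`. -/
theorem powerSum_partialSum_div {s c : ℕ → ℝ} {k : ℕ} (hk : k ≠ 0) (hs : PolyBounded s)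
    (hc : c 0 = 0) (h : ∀ n, s (n + 1) = s n + c (n + 1))
    (hck : ∀ x : ℝ, -1 < x → x < 0 → powerSum c x = -realPolylog k (x / (x - 1)))
    {x : ℝ} (hx1 : -1 < x) (hx0 : x < 0) :
    powerSum (fun n => s n / n) x = -realPolylog (k + 1) (x / (x - 1)) := by
  have hu : ∀ y : ℝ, -1 < y → y ≤ 0 → 0 ≤ y / (y - 1) ∧ y / (y - 1) < 1 / 2 := by
    intro y hy hy0
    have : 0 < 1 - y := by linarith
    rw [← neg_div_neg_eq, neg_sub, le_div_iff₀ this, div_lt_iff₀ this]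
    constructor <;> linarith
  have h := eq_of_hasDerivAt_eq (a := x) (b := 0) (f := powerSum fun n => s n / n)
    (g := fun x => -realPolylog (k + 1) (x / (x - 1))) (f' := fun x => powerSum s x / x)
    hx0.le (hs.continuousOn_div hx1) ?_ ?_ ?_
  · rw [powerSum_zero (by simp)] at h
    simp [realPolylog_zero] at h
    linarith
  · refine (ContinuousOn.realPolylog (f := fun x => x / (x - 1)) ?_ (by omega) ?_).neg
    · exact continuousOn_id.div (continuousOn_id.sub continuousOn_const)
        fun y hy => by simp at hy ⊢; linarith
    · intro y hy
      have := hu y (by linarith [hy.1]) hy.2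
      constructor <;> linarith
  · intro y ⟨hy1, hy0⟩
    exact hs.hasDerivAt (abs_lt.2 ⟨by linarith, by linarith⟩) hy0.ne
  · intro y ⟨hy1, hy0⟩
    have hyu := hu y (by linarith) hy0.le
    have hy : |y| < 1 := abs_lt.2 ⟨by linarith, by linarith⟩
    have hne : y - 1 ≠ 0 := by linarith
    have hne2 : 1 - y ≠ 0 := by linarith
    -- The logarithmic derivative of y/(y−1) is 1/(y(1−y)): exactly the factor 1/(1−y) from partial
    -- sums times 1/y from dividing by n.
    have hd : HasDerivAt (fun y : ℝ => y / (y - 1)) (-1 / (y - 1) ^ 2) y := by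
      refine ((hasDerivAt_id y).div ((hasDerivAt_id y).sub_const 1) hne).congr_deriv ?_
      simp
    refine (hd.realPolylog hk (abs_lt.2 ⟨by linarith, by linarith⟩)
      (div_ne_zero hy0.ne hne)).neg.congr_deriv ?_
    have e := one_sub_mul_powerSum hs hc h hy
    rw [hck y (by linarith) hy0] at e
    rw [eq_div_of_mul_eq hne2 ((mul_comm _ _).trans e)]
    have hy0' := hy0.ne
    field_simp
    ring

/-- The generating functions of the elementary symmetric functions of `1, 1/2, …, 1/n`. -/
theorem powerSum_strict_step {e q r : ℕ → ℝ} {k : ℕ} (he : PolyBounded e)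
    (hr : r 0 = 0) (hq : q 0 = 0)
    (her : ∀ n, e (n + 1) = e n + r (n + 1)) (hqe : ∀ n : ℕ, q (n + 1) = e n / (n + 1 : ℕ))
    (hek : ∀ x : ℝ, -1 < x → x < 0 → powerSum r x = (-Real.log (1 - x)) ^ k / k.factorial)
    {x : ℝ} (hx1 : -1 < x) (hx0 : x < 0) :
    powerSum q x = (-Real.log (1 - x)) ^ (k + 1) / (k + 1).factorial := by
  -- The shift multiplies the series by y and so cancels the 1/y of the derivative. At n = 0
  -- truncated subtraction gives e 0 = 0.
  set a : ℕ → ℝ := fun n => e (n - 1) with ha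
  have haP : PolyBounded a := by
    obtain ⟨h0, p, hp⟩ := he
    refine ⟨h0, p, fun n => (hp _).trans ?_⟩
    gcongr
    exact Nat.sub_le n 1
  have hqa : q = fun n => a n / n := by
    funext n
    cases n with
    | zero => simp [hq]
    | succ n => simp [hqe, ha]
  have h := eq_of_hasDerivAt_eq (a := x) (b := 0) (f := powerSum q)
    (g := fun x => (-Real.log (1 - x)) ^ (k + 1) / (k + 1).factorial)
    (f' := fun x => powerSum a x / x)
    hx0.le (hqa ▸ haP.continuousOn_div hx1) ?_ ?_ ?_
  · rw [powerSum_zero hq] at h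
    simp at h
    linarith
  · intro y hy
    exact ((((continuousAt_const.sub continuousAt_id).log
      (by have := hy.2; simp; linarith)).neg.pow _).div_const _).continuousWithinAt
  · intro y ⟨hy1, hy0⟩
    rw [hqa]
    exact haP.hasDerivAt (abs_lt.2 ⟨by linarith, by linarith⟩) hy0.ne
  · intro y ⟨hy1, hy0⟩
    have hy : |y| < 1 := abs_lt.2 ⟨by linarith, by linarith⟩
    have hne2 : 1 - y ≠ 0 := by linarith
    refine (((hasDerivAt_log_one_sub (by linarith)).neg.pow (k + 1)).div_const _).congr_deriv ?_
    have h1 := one_sub_mul_powerSum he hr her hy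
    have h2 : powerSum a y = y * powerSum e y := powerSum_shift haP (fun n => by simp [ha]) hy
    rw [hek y (by linarith) hy0] at h1
    rw [h2, mul_div_cancel_left₀ _ hy0.ne, eq_div_of_mul_eq hne2 ((mul_comm _ _).trans h1),
      Nat.factorial_succ]
    have : (k.factorial : ℝ) ≠ 0 := by positivity
    push_cast
    simp only [Pi.neg_apply]
    field_simp

/-! ### Symmetric functions of 1, 1/2, …, 1/n -/

theorem harmonic_succ_cast (n : ℕ) :
    (harmonic (n + 1) : ℝ) = harmonic n + 1 / (n + 1 : ℕ) := by
  rw [harmonic_succ]; push_cast; ring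

theorem genHarmonic_succ_cast (k n : ℕ) :
    (genHarmonic k (n + 1) : ℝ) = genHarmonic k n + 1 / ((n + 1 : ℕ) : ℝ) ^ k := by
  rw [genHarmonic, Finset.sum_Icc_succ_top (by omega), genHarmonic]; push_cast; ring

theorem genHarmonic_zero (k : ℕ) : genHarmonic k 0 = 0 := by simp [genHarmonic]

theorem genHarmonic_nonneg (k n : ℕ) : (0 : ℝ) ≤ genHarmonic k n := by
  induction n with
  | zero => simp [genHarmonic_zero]
  | succ n ih => rw [genHarmonic_succ_cast]; positivity

theorem genHarmonic_le (k n : ℕ) : (genHarmonic k n : ℝ) ≤ n := by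
  induction n with
  | zero => simp [genHarmonic_zero]
  | succ n ih =>
    rw [genHarmonic_succ_cast]
    have h : (1 : ℝ) / ((n + 1 : ℕ) : ℝ) ^ k ≤ 1 :=
      div_le_one_of_le₀ (one_le_pow₀ (by simp)) (by positivity)
    push_cast at h ⊢
    linarith

theorem harmonic_cast_nonneg (n : ℕ) : (0 : ℝ) ≤ harmonic n := by
  rw [← genHarmonic_one]; exact genHarmonic_nonneg 1 n

theorem harmonic_cast_le (n : ℕ) : (harmonic n : ℝ) ≤ n := by
  rw [← genHarmonic_one]; exact genHarmonic_le 1 n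

/-- The elementary symmetric function of degree two of `1, 1/2, …, 1/n`. -/
noncomputable def esymmTwo (n : ℕ) : ℝ := ((harmonic n : ℝ) ^ 2 - genHarmonic 2 n) / 2

/-- The elementary symmetric function of degree three of `1, 1/2, …, 1/n`. -/
noncomputable def esymmThree (n : ℕ) : ℝ :=
  ((harmonic n : ℝ) ^ 3 - 3 * (harmonic n * genHarmonic 2 n) + 2 * genHarmonic 3 n) / 6

/-- The complete homogeneous symmetric function of degree two of `1, 1/2, …, 1/n`. -/
noncomputable def hsymmTwo (n : ℕ) : ℝ := ((harmonic n : ℝ) ^ 2 + genHarmonic 2 n) / 2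

/-- The complete homogeneous symmetric function of degree three of `1, 1/2, …, 1/n`. -/
noncomputable def hsymmThree (n : ℕ) : ℝ :=
  ((harmonic n : ℝ) ^ 3 + 3 * (harmonic n * genHarmonic 2 n) + 2 * genHarmonic 3 n) / 6

theorem esymmTwo_succ (n : ℕ) : esymmTwo (n + 1) = esymmTwo n + harmonic n / (n + 1 : ℕ) := by
  simp only [esymmTwo, harmonic_succ_cast, genHarmonic_succ_cast]
  field_simp
  ring

theorem esymmThree_succ (n : ℕ) :
    esymmThree (n + 1) = esymmThree n + esymmTwo n / (n + 1 : ℕ) := by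
  simp only [esymmThree, esymmTwo, harmonic_succ_cast, genHarmonic_succ_cast]
  field_simp
  ring

/-- The new variable 1/(n+1) may repeat in a complete symmetric function, hence index n + 1 on the
right where the elementary recursion has n. -/
theorem hsymmTwo_succ (n : ℕ) :
    hsymmTwo (n + 1) = hsymmTwo n + harmonic (n + 1) / (n + 1 : ℕ) := by
  simp only [hsymmTwo, harmonic_succ_cast, genHarmonic_succ_cast]
  field_simp
  ring

theorem hsymmThree_succ (n : ℕ) :
    hsymmThree (n + 1) = hsymmThree n + hsymmTwo (n + 1) / (n + 1 : ℕ) := by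
  simp only [hsymmThree, hsymmTwo, harmonic_succ_cast, genHarmonic_succ_cast]
  field_simp
  ring

theorem polyBounded_genHarmonic (k : ℕ) : PolyBounded fun n => (genHarmonic k n : ℝ) := by
  refine ⟨by simp [genHarmonic_zero], 1, fun n => ?_⟩
  rw [abs_of_nonneg (genHarmonic_nonneg k n), pow_one]
  exact genHarmonic_le k n

theorem polyBounded_harmonic : PolyBounded fun n => (harmonic n : ℝ) := by
  simpa only [genHarmonic_one] using polyBounded_genHarmonic 1

theorem harmonic_monomial_le (n : ℕ) :
    (harmonic n : ℝ) ^ 2 ≤ n ^ 3 ∧ (harmonic n : ℝ) ^ 3 ≤ n ^ 3 ∧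
    (harmonic n * genHarmonic 2 n : ℝ) ≤ n ^ 3 ∧ ∀ k, (genHarmonic k n : ℝ) ≤ n ^ 3 := by
  have h0 := harmonic_cast_nonneg n
  have h1 := harmonic_cast_le n
  have hm : (n : ℝ) ^ 1 ≤ n ^ 3 ∧ (n : ℝ) ^ 2 ≤ n ^ 3 := by
    rcases Nat.eq_zero_or_pos n with rfl | hn
    · simp
    · constructor <;> exact_mod_cast Nat.pow_le_pow_right hn (by norm_num)
  refine ⟨(pow_le_pow_left₀ h0 h1 2).trans hm.2, pow_le_pow_left₀ h0 h1 3, ?_, fun k => ?_⟩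
  · refine le_trans ?_ hm.2
    rw [sq]
    exact mul_le_mul h1 (genHarmonic_le 2 n) (genHarmonic_nonneg 2 n) (by positivity)
  · exact (genHarmonic_le k n).trans (by simpa using hm.1)

theorem polyBounded_esymmTwo : PolyBounded esymmTwo := by
  refine ⟨by simp [esymmTwo, genHarmonic_zero], 3, fun n => ?_⟩
  obtain ⟨h1, h2, h3, h4⟩ := harmonic_monomial_le n
  have := genHarmonic_nonneg 2 n
  have := sq_nonneg (harmonic n : ℝ)
  rw [esymmTwo, abs_le]
  constructor <;> linarith [h4 2]

theorem polyBounded_hsymmTwo : PolyBounded hsymmTwo := by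
  refine ⟨by simp [hsymmTwo, genHarmonic_zero], 3, fun n => ?_⟩
  obtain ⟨h1, h2, h3, h4⟩ := harmonic_monomial_le n
  have := genHarmonic_nonneg 2 n
  have := sq_nonneg (harmonic n : ℝ)
  rw [hsymmTwo, abs_le]
  constructor <;> linarith [h4 2]

theorem polyBounded_esymmThree : PolyBounded esymmThree := by
  refine ⟨by simp [esymmThree, genHarmonic_zero], 3, fun n => ?_⟩
  obtain ⟨h1, h2, h3, h4⟩ := harmonic_monomial_le n
  have := genHarmonic_nonneg 3 n
  have := mul_nonneg (harmonic_cast_nonneg n) (genHarmonic_nonneg 2 n)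
  have := pow_nonneg (harmonic_cast_nonneg n) 3
  rw [esymmThree, abs_le]
  constructor <;> linarith [h4 3]

theorem polyBounded_hsymmThree : PolyBounded hsymmThree := by
  refine ⟨by simp [hsymmThree, genHarmonic_zero], 3, fun n => ?_⟩
  obtain ⟨h1, h2, h3, h4⟩ := harmonic_monomial_le n
  have := genHarmonic_nonneg 3 n
  have := mul_nonneg (harmonic_cast_nonneg n) (genHarmonic_nonneg 2 n)
  have := pow_nonneg (harmonic_cast_nonneg n) 3
  rw [hsymmThree, abs_le]
  constructor <;> linarith [h4 3]

/-! ### Generating functions of h₃, e₃ and p₃ -/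

/-- Since 1 − x/(x−1) = 1/(1−x), Li₁(x) = −Li₁(x/(x−1)); three partial-sum steps raise the order on
the right from 1 to 4. -/
theorem powerSum_hsymmThree_div {x : ℝ} (hx1 : -1 < x) (hx0 : x < 0) :
    powerSum (fun n => hsymmThree n / n) x = -realPolylog 4 (x / (x - 1)) := by
  have h1 := fun x hx1 hx0 => powerSum_partialSum_div (x := x) one_ne_zero polyBounded_harmonic
    (c := fun n => 1 / (n : ℝ) ^ 1) (by simp)
    (fun n => by rw [harmonic_succ_cast, pow_one]) (fun y hy1 hy0 => by
      have hne : y - 1 ≠ 0 := by linarith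
      have e : 1 - y / (y - 1) = (1 - y)⁻¹ := by
        have : 1 - y ≠ 0 := by linarith
        field_simp
        ring
      have hu : |y / (y - 1)| < 1 := by
        have : 0 < 1 - y := by linarith
        rw [← neg_div_neg_eq, neg_sub, abs_lt, lt_div_iff₀ this, div_lt_iff₀ this]
        constructor <;> linarith
      rw [realPolylog_one hu, e, Real.log_inv, neg_neg]
      exact realPolylog_one (abs_lt.2 ⟨hy1, by linarith⟩)) hx1 hx0
  have h2 := fun x hx1 hx0 => powerSum_partialSum_div (x := x) two_ne_zero polyBounded_hsymmTwo
    (c := fun n => (harmonic n : ℝ) / n) (by simp) hsymmTwo_succ h1 hx1 hx0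
  exact powerSum_partialSum_div three_ne_zero polyBounded_hsymmThree
    (c := fun n => hsymmTwo n / n) (by simp) hsymmThree_succ h2 hx1 hx0

theorem powerSum_esymmThree {x : ℝ} (hx1 : -1 < x) (hx0 : x < 0) :
    powerSum esymmThree x = (-Real.log (1 - x)) ^ 3 / 6 / (1 - x) := by
  have h1 := fun x hx1 hx0 => powerSum_strict_step (x := x) (k := 1) polyBounded_harmonic
    (r := fun n => 1 / (n : ℝ) ^ 1) (q := fun n => (harmonic (n - 1) : ℝ) / n) (by simp) (by simp)
    (fun n => by rw [harmonic_succ_cast, pow_one]) (fun n => by simp) (fun y hy1 hy0 => by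
      refine (realPolylog_one (abs_lt.2 ⟨hy1, by linarith⟩)).trans ?_
      simp) hx1 hx0
  have h2 := powerSum_strict_step polyBounded_esymmTwo
    (r := fun n => (harmonic (n - 1) : ℝ) / n) (q := fun n => esymmTwo (n - 1) / n)
    (by simp) (by simp) (fun n => by simpa using esymmTwo_succ n) (fun n => by simp) h1 hx1 hx0
  have h3 := one_sub_mul_powerSum polyBounded_esymmThree
    (b := fun n => esymmTwo (n - 1) / n) (by simp) (fun n => by simpa using esymmThree_succ n)
    (x := x) (abs_lt.2 ⟨hx1, by linarith⟩)
  rw [h2] at h3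
  rw [eq_div_iff (by linarith), mul_comm, h3]
  norm_num [Nat.factorial]

/-- Both sides have derivative Li₃(x)/(x(1−x)): the Li₂ terms on the right cancel because Li₁(x) =
−log(1−x). -/
theorem powerSum_genHarmonic_three_div {x : ℝ} (hx1 : -1 < x) (hx0 : x < 0) :
    powerSum (fun n => (genHarmonic 3 n : ℝ) / n) x
      = realPolylog 4 x - Real.log (1 - x) * realPolylog 3 x - realPolylog 2 x ^ 2 / 2 := by
  have hM := polyBounded_genHarmonic 3
  have h := eq_of_hasDerivAt_eq (a := x) (b := 0)
    (f := powerSum fun n => (genHarmonic 3 n : ℝ) / n)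
    (g := fun x => realPolylog 4 x - Real.log (1 - x) * realPolylog 3 x - realPolylog 2 x ^ 2 / 2)
    (f' := fun x => powerSum (fun n => (genHarmonic 3 n : ℝ)) x / x)
    hx0.le (hM.continuousOn_div hx1) ?_ ?_ ?_
  · rw [powerSum_zero (by simp)] at h
    simp [realPolylog_zero] at h
    linarith
  · have hc : ∀ k, 2 ≤ k → ContinuousOn (realPolylog k) (Set.Icc x 0) := fun k hk =>
      (continuousOn_realPolylog hk).mono (Set.Icc_subset_Icc hx1.le zero_le_one)
    refine ((hc 4 (by norm_num)).sub (ContinuousOn.mul ?_ (hc 3 (by norm_num)))).sub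
      (((hc 2 le_rfl).pow 2).div_const 2)
    exact (continuousOn_const.sub continuousOn_id).log fun y hy => by
      simp at hy ⊢; linarith
  · intro y ⟨hy1, hy0⟩
    exact hM.hasDerivAt (abs_lt.2 ⟨by linarith, by linarith⟩) hy0.ne
  · intro y ⟨hy1, hy0⟩
    have hy : |y| < 1 := abs_lt.2 ⟨by linarith, by linarith⟩
    have hne2 : 1 - y ≠ 0 := by linarith
    have e := one_sub_mul_powerSum hM (b := fun n => 1 / (n : ℝ) ^ 3) (by simp)
      (genHarmonic_succ_cast 3) hy
    rw [show powerSum (fun n => 1 / (n : ℝ) ^ 3) y = realPolylog 3 y from rfl] at e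
    refine (((hasDerivAt_realPolylog three_ne_zero hy hy0.ne).sub
      ((hasDerivAt_log_one_sub (by linarith)).mul
        (hasDerivAt_realPolylog two_ne_zero hy hy0.ne))).sub
      (((hasDerivAt_realPolylog one_ne_zero hy hy0.ne).pow 2).div_const 2)).congr_deriv ?_
    rw [eq_div_of_mul_eq hne2 ((mul_comm _ _).trans e), realPolylog_one hy]
    have := hy0.ne
    simp only [Nat.reduceAdd]
    field_simp
    ring

/-- A primitive of `-log³ y / (1 - y)`. -/
noncomputable def logCubePrimitive (y : ℝ) : ℝ :=
  Real.log y ^ 2 * (Real.log y * Real.log (1 - y)) + 3 * Real.log y ^ 2 * realPolylog 2 y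
    - 6 * Real.log y * realPolylog 3 y + 6 * realPolylog 4 y

theorem continuousOn_logCubePrimitive : ContinuousOn logCubePrimitive (Set.Ioc 0 1) := by
  have hlog : ContinuousOn Real.log (Set.Ioc 0 1) :=
    Real.continuousOn_log.mono fun x hx => hx.1.ne'
  have hc : ∀ k, 2 ≤ k → ContinuousOn (realPolylog k) (Set.Ioc 0 1) := fun k hk =>
    (continuousOn_realPolylog hk).mono fun x hx => ⟨by linarith [hx.1], hx.2⟩
  exact ((((hlog.pow 2).mul continuousOn_log_mul_log_one_sub).add
    ((continuousOn_const.mul (hlog.pow 2)).mul (hc 2 le_rfl))).sub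
    ((continuousOn_const.mul hlog).mul (hc 3 (by norm_num)))).add
    (continuousOn_const.mul (hc 4 (by norm_num)))

theorem hasDerivAt_logCubePrimitive {y : ℝ} (hy0 : 0 < y) (hy1 : y < 1) :
    HasDerivAt logCubePrimitive (-Real.log y ^ 3 / (1 - y)) y := by
  have hy : |y| < 1 := abs_lt.2 ⟨by linarith, hy1⟩
  have hlog := Real.hasDerivAt_log hy0.ne'
  have hne : 1 - y ≠ 0 := by linarith
  refine (((((hlog.pow 2).mul (hlog.mul (hasDerivAt_log_one_sub hy1))).add
    (((hlog.pow 2).const_mul 3).mul (hasDerivAt_realPolylog one_ne_zero hy hy0.ne'))).sub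
    ((hlog.const_mul 6).mul (hasDerivAt_realPolylog two_ne_zero hy hy0.ne'))).add
    ((hasDerivAt_realPolylog three_ne_zero hy hy0.ne').const_mul 6)).congr_deriv ?_
  rw [realPolylog_one hy]
  simp only [Nat.reduceAdd, Pi.mul_apply, Pi.pow_apply]
  field_simp
  ring

/-- With x = 1 − 1/y, −log(1−x) becomes log y, and the integrand becomes −log³y/(6(1−y)). The
constant is fixed at y = 1, that is x = 0. -/
theorem powerSum_esymmThree_div {y : ℝ} (hy0 : 1 / 2 < y) (hy1 : y < 1) :
    powerSum (fun n => esymmThree n / n) (1 - 1 / y)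
      = (logCubePrimitive y - 6 * realPolylog 4 1) / 6 := by
  have hu : ∀ z : ℝ, y ≤ z → z ≤ 1 → 1 - 1 / y ≤ 1 - 1 / z ∧ 1 - 1 / z ≤ 0 := by
    intro z hz hz1
    have hz0 : 0 < z := by linarith
    constructor
    · gcongr
    · rw [sub_nonpos, le_div_iff₀ hz0]; linarith
  have hy' : -1 < 1 - 1 / y := by
    have : 1 / y < 2 := by rw [div_lt_iff₀ (by linarith)]; linarith
    linarith
  have h := eq_of_hasDerivAt_eq (a := y) (b := 1)
    (f := fun y => powerSum (fun n => esymmThree n / n) (1 - 1 / y))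
    (g := fun y => (logCubePrimitive y - 6 * realPolylog 4 1) / 6)
    (f' := fun y => -Real.log y ^ 3 / (1 - y) / 6) hy1.le ?_ ?_ ?_ ?_
  · simp only [div_one, sub_self] at h
    rw [powerSum_zero (by simp)] at h
    simp [logCubePrimitive] at h
    simp only [one_div, logCubePrimitive]
    linarith
  · refine (polyBounded_esymmThree.continuousOn_div hy').comp
      (continuousOn_const.sub (continuousOn_const.div continuousOn_id fun z hz => ?_))
      fun z hz => hu z hz.1 hz.2
    have := hz.1
    simp
    linarith
  · exact ((continuousOn_logCubePrimitive.mono fun z hz => ⟨by linarith [hz.1], hz.2⟩).sub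
      continuousOn_const).div_const 6
  · intro z ⟨hz0, hz1⟩
    have hzu := hu z hz0.le hz1.le
    have hzpos : 0 < z := by linarith
    have hlt : 1 - 1 / z < 0 := by rw [sub_neg, lt_div_iff₀ hzpos]; linarith
    have hinv : HasDerivAt (fun z : ℝ => 1 - 1 / z) (1 / z ^ 2) z := by
      simpa using (hasDerivAt_inv hzpos.ne').const_sub 1
    refine ((polyBounded_esymmThree.hasDerivAt (x := 1 - 1 / z)
      (abs_lt.2 ⟨by linarith, by linarith⟩) hlt.ne).comp z hinv).congr_deriv ?_
    rw [powerSum_esymmThree (by linarith) hlt, sub_sub_cancel, one_div, Real.log_inv]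
    have h1 : z - 1 ≠ 0 := by linarith
    have h2 : 1 - z ≠ 0 := by linarith
    field_simp
    ring
  · intro z ⟨hz0, hz1⟩
    exact ((hasDerivAt_logCubePrimitive (by linarith) hz1).sub_const _).div_const 6

/-! ### Limits of the generating functions at −1 -/

theorem eventually_neg_one_lt_and_neg : ∀ᶠ x : ℝ in 𝓝[>] (-1), -1 < x ∧ x < 0 :=
  Ioo_mem_nhdsGT (by norm_num)

theorem tendsto_realPolylog_neg_one {k : ℕ} (hk : 2 ≤ k) :
    Tendsto (realPolylog k) (𝓝[>] (-1)) (𝓝 (realPolylog k (-1))) :=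
  ((continuousOn_realPolylog hk) (-1) (by simp)).mono_of_mem_nhdsWithin
    (mem_of_superset (Ioo_mem_nhdsGT (by norm_num : (-1 : ℝ) < 1)) Set.Ioo_subset_Icc_self)

theorem tendsto_powerSum_hsymmThree_div :
    Tendsto (powerSum fun n => hsymmThree n / n) (𝓝[>] (-1)) (𝓝 (-realPolylog 4 (1 / 2))) := by
  have h1 : ContinuousAt (realPolylog 4) ((-1 : ℝ) / (-1 - 1)) :=
    (continuousOn_realPolylog (by norm_num)).continuousAt
      (Icc_mem_nhds (by norm_num) (by norm_num))
  have h2 : ContinuousAt (fun x : ℝ => x / (x - 1)) (-1) :=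
    continuousAt_id.div (continuousAt_id.sub continuousAt_const) (by norm_num)
  have h3 : ContinuousAt (fun x : ℝ => -realPolylog 4 (x / (x - 1))) (-1) :=
    (ContinuousAt.comp (f := fun x : ℝ => x / (x - 1)) h1 h2).neg
  have h4 := h3.tendsto.mono_left (nhdsWithin_le_nhds (s := Set.Ioi (-1)))
  rw [show (-1 : ℝ) / (-1 - 1) = 1 / 2 by norm_num] at h4
  refine h4.congr' ?_
  filter_upwards [eventually_neg_one_lt_and_neg] with x hx
  exact (powerSum_hsymmThree_div hx.1 hx.2).symm

theorem tendsto_powerSum_esymmThree_div :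
    Tendsto (powerSum fun n => esymmThree n / n) (𝓝[>] (-1))
      (𝓝 ((logCubePrimitive (1 / 2) - 6 * realPolylog 4 1) / 6)) := by
  have h1 : ContinuousAt logCubePrimitive (1 / (1 - (-1 : ℝ))) :=
    continuousOn_logCubePrimitive.continuousAt (Ioc_mem_nhds (by norm_num) (by norm_num))
  have h2 : ContinuousAt (fun x : ℝ => 1 / (1 - x)) (-1) :=
    continuousAt_const.div (continuousAt_const.sub continuousAt_id) (by norm_num)
  have h3 : ContinuousAt (fun x : ℝ => (logCubePrimitive (1 / (1 - x)) - 6 * realPolylog 4 1) / 6)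
      (-1) :=
    ((ContinuousAt.comp (f := fun x : ℝ => 1 / (1 - x)) h1 h2).sub continuousAt_const).div_const 6
  have h4 := h3.tendsto.mono_left (nhdsWithin_le_nhds (s := Set.Ioi (-1)))
  rw [show (1 : ℝ) / (1 - -1) = 1 / 2 by norm_num] at h4
  refine h4.congr' ?_
  filter_upwards [eventually_neg_one_lt_and_neg] with x hx
  have hpos : 0 < 1 - x := by linarith [hx.2]
  rw [← powerSum_esymmThree_div, one_div_one_div, sub_sub_cancel]
  · rw [lt_div_iff₀ hpos]; linarith
  · rw [div_lt_iff₀ hpos]; linarith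

theorem tendsto_powerSum_genHarmonic_three_div :
    Tendsto (powerSum fun n => (genHarmonic 3 n : ℝ) / n) (𝓝[>] (-1))
      (𝓝 (realPolylog 4 (-1) - Real.log 2 * realPolylog 3 (-1) - realPolylog 2 (-1) ^ 2 / 2)) := by
  have hlog : Tendsto (fun x : ℝ => Real.log (1 - x)) (𝓝[>] (-1)) (𝓝 (Real.log 2)) := by
    have : ContinuousAt (fun x : ℝ => Real.log (1 - x)) (-1) :=
      (continuousAt_const.sub continuousAt_id).log (by norm_num)
    have h := this.tendsto.mono_left (nhdsWithin_le_nhds (s := Set.Ioi (-1)))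
    rwa [show (1 : ℝ) - -1 = 2 by norm_num] at h
  refine (((tendsto_realPolylog_neg_one (k := 4) (by norm_num)).sub
    (hlog.mul (tendsto_realPolylog_neg_one (k := 3) (by norm_num)))).sub
    (((tendsto_realPolylog_neg_one (k := 2) le_rfl).pow 2).div_const 2)).congr' ?_
  filter_upwards [eventually_neg_one_lt_and_neg] with x hx
  exact (powerSum_genHarmonic_three_div hx.1 hx.2).symm

/-! ### Abel summation of alternating series -/

theorem exists_tendsto_alternating_of_eventually_antitone {b : ℕ → ℝ} {N : ℕ}
    (hb : ∀ n, N ≤ n → b (n + 1) ≤ b n) (h0 : Tendsto b atTop (𝓝 0)) :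
    ∃ l, Tendsto (fun n => ∑ i ∈ Finset.range n, (-1) ^ i * b i) atTop (𝓝 l) := by
  have ha : Antitone fun n => b (N + n) := antitone_nat_of_succ_le fun n => hb (N + n) (by omega)
  have h0' : Tendsto (fun n => b (N + n)) atTop (𝓝 0) := by
    simpa only [add_comm N] using (tendsto_add_atTop_iff_nat N).2 h0
  obtain ⟨l, hl⟩ := ha.tendsto_alternating_series_of_tendsto_zero h0'
  refine ⟨∑ i ∈ Finset.range N, (-1) ^ i * b i + (-1) ^ N * l, ?_⟩
  rw [← tendsto_add_atTop_iff_nat N]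
  refine ((hl.const_mul ((-1) ^ N)).const_add _).congr fun n => ?_
  rw [add_comm n N, Finset.sum_range_add, Finset.mul_sum]
  simp only [pow_add, mul_assoc]

theorem sum_Icc_alternating {b : ℕ → ℝ} (hb : b 0 = 0) (N : ℕ) :
    ∑ n ∈ Finset.Icc 1 N, b n * (-1) ^ (n - 1)
      = -∑ i ∈ Finset.range (N + 1), (-1) ^ i * b i := by
  induction N with
  | zero => simp [hb]
  | succ N ih =>
    rw [Finset.sum_Icc_succ_top (by omega), ih, Finset.sum_range_succ _ (N + 1), Nat.add_sub_cancel]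
    ring

/-- Abel summation of an alternating series whose terms eventually decrease to zero. -/
theorem tendsto_alternating_of_powerSum {b : ℕ → ℝ} {N : ℕ} {v : ℝ} (hb0 : b 0 = 0)
    (hb : ∀ n, N ≤ n → b (n + 1) ≤ b n) (h0 : Tendsto b atTop (𝓝 0))
    (hv : Tendsto (powerSum b) (𝓝[>] (-1)) (𝓝 v)) :
    Tendsto (fun N => ∑ n ∈ Finset.Icc 1 N, b n * (-1) ^ (n - 1)) atTop (𝓝 (-v)) := by
  obtain ⟨l, hl⟩ := exists_tendsto_alternating_of_eventually_antitone hb h0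
  have habel := Real.tendsto_tsum_powerSeries_nhdsWithin_lt hl
  -- Abel's theorem concerns coefficients (−1)ⁱbᵢ as z → 1 from the left; z ↦ −z turns this into the
  -- series of b as x → −1 from the right.
  have hneg : Tendsto (fun z : ℝ => -z) (𝓝[<] 1) (𝓝[>] (-1)) := by
    refine tendsto_nhdsWithin_of_tendsto_nhds_of_eventually_within _
      (tendsto_nhdsWithin_of_tendsto_nhds (continuous_neg.tendsto 1)) ?_
    filter_upwards [self_mem_nhdsWithin] with z hz
    simpa using hz
  have heq : l = v := by
    refine tendsto_nhds_unique habel ((hv.comp hneg).congr fun z => tsum_congr fun n => ?_)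
    rw [neg_pow]
    ring
  subst heq
  simp only [sum_Icc_alternating hb0]
  exact ((tendsto_add_atTop_iff_nat 1).2 hl).neg

/-! ### Decay and eventual monotonicity of the terms -/

theorem exists_forall_four_le_harmonic : ∃ N : ℕ, ∀ n, N ≤ n → (4 : ℝ) ≤ harmonic n := by
  have h : Tendsto (fun n : ℕ => Real.log ((n + 1 : ℕ) : ℝ)) atTop atTop :=
    Real.tendsto_log_atTop.comp
      (tendsto_natCast_atTop_atTop.comp (tendsto_add_atTop_nat 1))
  obtain ⟨N, hN⟩ := eventually_atTop.1 (h.eventually_ge_atTop 4)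
  exact ⟨N, fun n hn => (hN n hn).trans (log_add_one_le_harmonic n)⟩

theorem one_le_genHarmonic {k n : ℕ} (hn : 1 ≤ n) : (1 : ℝ) ≤ genHarmonic k n := by
  induction n, hn using Nat.le_induction with
  | base => simp [genHarmonic]
  | succ n _ ih =>
    rw [genHarmonic_succ_cast]
    have : (0 : ℝ) ≤ 1 / ((n + 1 : ℕ) : ℝ) ^ k := by positivity
    linarith

theorem genHarmonic_two_le_harmonic (n : ℕ) : (genHarmonic 2 n : ℝ) ≤ harmonic n := by
  induction n with
  | zero => simp [genHarmonic_zero]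
  | succ n ih =>
    rw [genHarmonic_succ_cast, harmonic_succ_cast]
    have h : (1 : ℝ) ≤ (n + 1 : ℕ) := by simp
    have : (1 : ℝ) / ((n + 1 : ℕ) : ℝ) ^ 2 ≤ 1 / (n + 1 : ℕ) :=
      one_div_le_one_div_of_le (by positivity) (le_self_pow₀ h two_ne_zero)
    linarith

theorem tendsto_harmonic_cube_div :
    Tendsto (fun n : ℕ => (harmonic n : ℝ) ^ 3 / n) atTop (𝓝 0) := by
  have h : Tendsto (fun x : ℝ => (1 + Real.log x) ^ 3 / x) atTop (𝓝 0) := by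
    have hk : ∀ k : ℕ, Tendsto (fun x : ℝ => Real.log x ^ k / x) atTop (𝓝 0) := fun k => by
      simpa using (Real.isLittleO_pow_log_id_atTop (n := k)).tendsto_div_nhds_zero
    have := (((hk 0).add ((hk 1).const_mul 3)).add ((hk 2).const_mul 3)).add (hk 3)
    simp only [mul_zero, add_zero] at this
    exact this.congr fun x => by ring
  refine squeeze_zero (fun n => ?_) (fun n => ?_) (h.comp tendsto_natCast_atTop_atTop)
  · exact div_nonneg (pow_nonneg (harmonic_cast_nonneg n) 3) n.cast_nonneg
  · exact div_le_div_of_nonneg_right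
      (pow_le_pow_left₀ (harmonic_cast_nonneg n) (harmonic_le_one_add_log n) 3) n.cast_nonneg

theorem tendsto_harmonic_mul_genHarmonic_div :
    Tendsto (fun n : ℕ => (harmonic n : ℝ) * genHarmonic 2 n / n) atTop (𝓝 0) := by
  refine squeeze_zero (fun n => ?_) (fun n => ?_) tendsto_harmonic_cube_div
  · exact div_nonneg (mul_nonneg (harmonic_cast_nonneg n) (genHarmonic_nonneg 2 n)) n.cast_nonneg
  · refine div_le_div_of_nonneg_right ?_ n.cast_nonneg
    rcases Nat.eq_zero_or_pos n with rfl | hn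
    · simp
    · have h1 : (1 : ℝ) ≤ harmonic n := by
        rw [← genHarmonic_one]; exact one_le_genHarmonic hn
      have h2 := genHarmonic_two_le_harmonic n
      have h3 := harmonic_cast_nonneg n
      calc (harmonic n : ℝ) * genHarmonic 2 n ≤ harmonic n * harmonic n := by gcongr
        _ = (harmonic n : ℝ) ^ 2 := (sq _).symm
        _ ≤ (harmonic n : ℝ) ^ 3 := pow_le_pow_right₀ h1 (by norm_num)

theorem harmonic_cube_div_succ_le {n : ℕ} (h4 : (4 : ℝ) ≤ harmonic n) :
    (harmonic (n + 1) : ℝ) ^ 3 / (n + 1 : ℕ) ≤ (harmonic n : ℝ) ^ 3 / n := by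
  have hn : (0 : ℝ) < n := by linarith [harmonic_cast_le n]
  rw [harmonic_succ_cast, div_le_div_iff₀ (by positivity) hn]
  set H : ℝ := (harmonic n : ℝ)
  set d : ℝ := 1 / (n + 1 : ℕ) with hd
  have hd0 : 0 < d := by positivity
  have hnd : n * d = 1 - d := by rw [hd]; push_cast; field_simp; ring
  have hd1 : d ≤ 1 := by nlinarith
  push_cast
  -- Source of the threshold 4: there it reads 61 ≤ 64, while it fails at 3.
  have key : 3 * H ^ 2 + 3 * H + 1 ≤ H ^ 3 := by
    nlinarith [mul_nonneg (sub_nonneg.2 h4) (sq_nonneg H)]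
  have e : (H + d) ^ 3 * n = H ^ 3 * n + (3 * H ^ 2 + 3 * H * d + d ^ 2) * (n * d) := by ring
  rw [e]
  have h1 : 3 * H ^ 2 + 3 * H * d + d ^ 2 ≤ H ^ 3 := by nlinarith
  have h2 : (3 * H ^ 2 + 3 * H * d + d ^ 2) * (n * d) ≤ H ^ 3 * 1 :=
    mul_le_mul h1 (by linarith) (by positivity) (by positivity)
  linarith

theorem harmonic_mul_genHarmonic_div_succ_le {n : ℕ} (h4 : (4 : ℝ) ≤ harmonic n) :
    (harmonic (n + 1) : ℝ) * genHarmonic 2 (n + 1) / (n + 1 : ℕ)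
      ≤ (harmonic n : ℝ) * genHarmonic 2 n / n := by
  have hn : (4 : ℝ) ≤ n := h4.trans (harmonic_cast_le n)
  have hK : (1 : ℝ) ≤ genHarmonic 2 n := one_le_genHarmonic (by
    have : (0 : ℝ) < n := by linarith
    exact_mod_cast this)
  rw [harmonic_succ_cast, genHarmonic_succ_cast, ← one_div_pow,
    div_le_div_iff₀ (by positivity) (by linarith)]
  set H : ℝ := (harmonic n : ℝ)
  set K : ℝ := (genHarmonic 2 n : ℝ)
  set d : ℝ := 1 / (n + 1 : ℕ) with hd
  have hd0 : 0 < d := by positivity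
  have hnd : n * d = 1 - d := by rw [hd]; push_cast; field_simp; ring
  have hd1 : d ≤ 1 / 4 := by nlinarith
  push_cast
  have e : (H + d) * (K + d ^ 2) * n = H * K * n + (K + H * d + d ^ 2) * (n * d) := by ring
  rw [e]
  -- Each of K, Hd and d² is at most HK/4, the last because d² ≤ 1 ≤ K.
  have hHK : 4 * K ≤ H * K := by nlinarith
  have hHd : H * d ≤ H * K / 4 := by nlinarith [mul_nonneg (by linarith : 0 ≤ H) (sub_nonneg.2 hK)]
  have hdd : d ^ 2 ≤ 1 := by nlinarith
  have h1 : K + H * d + d ^ 2 ≤ H * K := by linarith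
  have h2 : (K + H * d + d ^ 2) * (n * d) ≤ H * K * 1 :=
    mul_le_mul h1 (by linarith) (by positivity) (by positivity)
  linarith

/-! ### Assembly of the two sums -/

theorem tendsto_powerSum_harmonic_cube_div {u v w : ℝ}
    (hu : Tendsto (powerSum fun n => hsymmThree n / n) (𝓝[>] (-1)) (𝓝 u))
    (hv : Tendsto (powerSum fun n => esymmThree n / n) (𝓝[>] (-1)) (𝓝 v))
    (hw : Tendsto (powerSum fun n => (genHarmonic 3 n : ℝ) / n) (𝓝[>] (-1)) (𝓝 w)) :
    Tendsto (powerSum fun n => (harmonic n : ℝ) ^ 3 / n) (𝓝[>] (-1))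
      (𝓝 (3 * (u + v) - 2 * w)) := by
  refine (((hu.add hv).const_mul 3).sub (hw.const_mul 2)).congr' ?_
  filter_upwards [eventually_neg_one_lt_and_neg] with x hx
  have hx' : |x| < 1 := abs_lt.2 ⟨hx.1, by linarith [hx.2]⟩
  have s1 := polyBounded_hsymmThree.div_natCast.summable hx'
  have s2 := polyBounded_esymmThree.div_natCast.summable hx'
  have s3 := (polyBounded_genHarmonic 3).div_natCast.summable hx'
  rw [powerSum, powerSum, powerSum, powerSum, ← s1.tsum_add s2, ← tsum_mul_left, ← tsum_mul_left,
    ← ((s1.add s2).mul_left 3).tsum_sub (s3.mul_left 2)]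
  refine tsum_congr fun n => ?_
  rw [hsymmThree, esymmThree]
  ring

theorem tendsto_powerSum_harmonic_mul_genHarmonic_div {u v : ℝ}
    (hu : Tendsto (powerSum fun n => hsymmThree n / n) (𝓝[>] (-1)) (𝓝 u))
    (hv : Tendsto (powerSum fun n => esymmThree n / n) (𝓝[>] (-1)) (𝓝 v)) :
    Tendsto (powerSum fun n => (harmonic n : ℝ) * genHarmonic 2 n / n) (𝓝[>] (-1))
      (𝓝 (u - v)) := by
  refine (hu.sub hv).congr' ?_
  filter_upwards [eventually_neg_one_lt_and_neg] with x hx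
  have hx' : |x| < 1 := abs_lt.2 ⟨hx.1, by linarith [hx.2]⟩
  have s1 := polyBounded_hsymmThree.div_natCast.summable hx'
  have s2 := polyBounded_esymmThree.div_natCast.summable hx'
  rw [powerSum, powerSum, powerSum, ← s1.tsum_sub s2]
  refine tsum_congr fun n => ?_
  rw [hsymmThree, esymmThree]
  ring

theorem realPolylog_two_one : realPolylog 2 1 = Real.pi ^ 2 / 6 := by
  have h := riemannZeta_eq_realPolylog (k := 2) (by norm_num)
  rw [Nat.cast_ofNat, riemannZeta_two] at h
  exact_mod_cast h.symm

theorem realPolylog_four_one : realPolylog 4 1 = Real.pi ^ 4 / 90 := by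
  have h := riemannZeta_eq_realPolylog (k := 4) (by norm_num)
  rw [Nat.cast_ofNat, riemannZeta_four] at h
  exact_mod_cast h.symm

theorem logCubePrimitive_half :
    logCubePrimitive (1 / 2) = Real.log 2 ^ 4 / 2 + 21 / 4 * realPolylog 3 1 * Real.log 2
      - 3 / 2 * realPolylog 2 1 * Real.log 2 ^ 2 + 6 * realPolylog 4 (1 / 2) := by
  rw [logCubePrimitive, realPolylog_two_half, realPolylog_three_half,
    show (1 : ℝ) - 1 / 2 = 1 / 2 by norm_num, show Real.log (1 / 2) = -Real.log 2 by
      rw [one_div, Real.log_inv]]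
  ring

/-- The sums of the two (conditionally convergent) alternating series are limits of their partial
sums, which are real numbers regarded as elements of `ℂ`, where the zeta values live. -/
theorem corollary2p8 :
    Tendsto
      (fun N : ℕ => ((∑ n ∈ Finset.Icc 1 N,
        (harmonic n : ℝ) ^ 3 / (n : ℝ) * (-1) ^ (n - 1) : ℝ) : ℂ))
      atTop
      (𝓝 (5 / 8 * riemannZeta 4 + 3 / 4 * riemannZeta 2 * (Real.log 2 : ℂ) ^ 2
        - 1 / 4 * (Real.log 2 : ℂ) ^ 4 - 9 / 8 * riemannZeta 3 * (Real.log 2 : ℂ))) ∧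
    Tendsto
      (fun N : ℕ => ((∑ n ∈ Finset.Icc 1 N,
        (harmonic n : ℝ) * (genHarmonic 2 n : ℝ) / (n : ℝ) * (-1) ^ (n - 1) : ℝ) : ℂ))
      atTop
      (𝓝 (2 * polylog 4 (1 / 2) + 1 / 12 * (Real.log 2 : ℂ) ^ 4
        + 7 / 8 * riemannZeta 3 * (Real.log 2 : ℂ)
        - 1 / 4 * riemannZeta 2 * (Real.log 2 : ℂ) ^ 2 - riemannZeta 4)) := by
  obtain ⟨N, hN⟩ := exists_forall_four_le_harmonic
  have hA := tendsto_alternating_of_powerSum (by simp)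
    (fun n hn => harmonic_cube_div_succ_le (hN n hn)) tendsto_harmonic_cube_div
    (tendsto_powerSum_harmonic_cube_div tendsto_powerSum_hsymmThree_div
      tendsto_powerSum_esymmThree_div tendsto_powerSum_genHarmonic_three_div)
  have hB := tendsto_alternating_of_powerSum (by simp)
    (fun n hn => harmonic_mul_genHarmonic_div_succ_le (hN n hn))
    tendsto_harmonic_mul_genHarmonic_div
    (tendsto_powerSum_harmonic_mul_genHarmonic_div tendsto_powerSum_hsymmThree_div
      tendsto_powerSum_esymmThree_div)
  have hz2 : riemannZeta 2 = (realPolylog 2 1 : ℂ) := riemannZeta_eq_realPolylog (by norm_num)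
  have hz3 : riemannZeta 3 = (realPolylog 3 1 : ℂ) := riemannZeta_eq_realPolylog (by norm_num)
  have hz4 : riemannZeta 4 = (realPolylog 4 1 : ℂ) := riemannZeta_eq_realPolylog (by norm_num)
  have hli : polylog 4 (1 / 2) = (realPolylog 4 (1 / 2) : ℂ) := by
    have h := polylog_ofReal (k := 4) (x := 1 / 2) (by norm_num) (by norm_num [abs_of_pos])
    push_cast at h
    exact h
  rw [hz2, hz3, hz4, hli]
  -- ζ(2)² = (5/2)ζ(4) is needed for the term Li₂(−1)²/2 of the p₃ series, so only for the first
  -- sum.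
  have hsq : realPolylog 2 1 ^ 2 = 5 / 2 * realPolylog 4 1 := by
    rw [realPolylog_two_one, realPolylog_four_one]; ring
  constructor
  · refine (Complex.continuous_ofReal.tendsto' _ _ ?_).comp hA
    rw [realPolylog_neg_one (k := 4) (by norm_num), realPolylog_neg_one (k := 3) (by norm_num),
      realPolylog_neg_one (k := 2) le_rfl, logCubePrimitive_half, mul_pow, hsq]
    push_cast
    ring
  · refine (Complex.continuous_ofReal.tendsto' _ _ ?_).comp hB
    rw [logCubePrimitive_half]
    push_cast
    ring
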